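/- A finite valuation ring is a finite commutative ring $\mathcal R$ with identity that is local and in which every ideal is principal. Let $z$ generate its maximal ideal, let $q=|\mathcal R/(z)|$ be the size of its residue field, and let $r$ be the smallest positive integer with $z^r=0$; then $|\mathcal R|=q^r$. For $\mathcal A\subset\mathcal R$ put $\mathcal A+\mathcal A=\{a+b: a,b\in\mathcal A\}$, $\mathcal A^2=\{a^2: a\in\mathcal A\}$, $\mathcal A^2+\mathcal A^2=\{a^2+b^2: a,b\in\mathcal A\}$ and $$M(\mathcal A)=\max\{|\mathcal A+\mathcal A|,\ |\mathcal A^2+\mathcal A^2|\}.$$ In each statement below, $\mathcal R$ ranges over all finite valuation rings for which $q$ is odd (equivalently, a power of an odd prime), with $q$ and $r$ as above, and $\mathcal A$ ranges over all subsets of $\mathcal R$. 1. For every $c>0$ there is a constant $C>0$ depending only on $c$ such that, if $|\mathcal A|\ge c\,q^{r-\frac13}$, then $$M(\mathcal A)\ge C\,q^{\frac r2}|\mathcal A|^{\frac12}.$$ 2. For all $c_1,c_2>0$ there is a constant $C>0$ depending only on $c_1,c_2$ such that, if $c_1q^{r-\frac38}\le|\mathcal A|\le c_2q^{r-\frac13}$,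 then $$M(\mathcal A)\ge C\,\frac{|\mathcal A|^2}{q^{\frac{2r-1}2}}.$$ 3. For all $c_1,c_2>0$ there is a constant $C>0$ depending only on $c_1,c_2$ such that, if $|\mathcal A+\mathcal A||\mathcal A|^2\ge c_1q^{3r-1}$ and $2q^{r-1}\le|\mathcal A|\le c_2q^{r-\frac38}$, then $$M(\mathcal A)\ge C\,q^{\frac r3}|\mathcal A|^{\frac23}.$$ -/

import Mathlib

open scoped Pointwise

/-- The number `q` of elements of the residue field `R / 𝔪` of a local ring `R`. -/
noncomputable def residueCard (R : Type*) [CommRing R] [IsLocalRing R] : ℕ :=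
  Nat.card (R ⧸ IsLocalRing.maximalIdeal R)

/-- The nilpotency degree of the maximal ideal `𝔪` of a local ring: the smallest positive
integer `r` with `𝔪 ^ r = 0`. If `𝔪 = (z)` then `𝔪 ^ k = (z ^ k)`, so this is the smallest
positive `r` with `z ^ r = 0`, for any uniformizer `z`. It is `1` for a field. -/
noncomputable def nilpotencyDegree (R : Type*) [CommRing R] [IsLocalRing R] : ℕ :=
  sInf {k : ℕ | 0 < k ∧ IsLocalRing.maximalIdeal R ^ k = ⊥}

/-- The set `{x ^ 2 : x ∈ A}` of squares of elements of `A`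
(not the set of all products of two elements of `A`). -/
def squares {R : Type*} [CommRing R] [DecidableEq R] (A : Finset R) : Finset R :=
  A.image fun x => x ^ 2

/-- The larger of the cardinalities of `A + A` and of `{x ^ 2 + y ^ 2 : x, y ∈ A}`,
as a real number. -/
def maxSumset {R : Type*} [CommRing R] [DecidableEq R] (A : Finset R) : ℝ :=
  ((max (A + A).card (squares A + squares A).card : ℕ) : ℝ)

/-! ### Sizes of the ring and its maximal ideal. -/

section Cardinality

variable {R : Type*} [CommRing R] [IsLocalRing R]

/-! Write N = |R| = q^r, n = |𝔪| = N/q, M = M(A). For a set B of units, take the grid (B + B) × (B²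
+ B²) and the parabolas with vertices (b, e) in B × B². Each contains the |B| grid points (a + b, a²
+ e). A second-moment bound (`parabola_incidence_bound`) shows that so many incidences need a large
grid, hence a large product |B + B||B² + B²|.

Taking B to be the units of A yields M² ≳ min(N|A|, |A|⁴q/N²) once |A| ≳ q^(r-3/8)
(`maxSumset_sq_ge`). The two terms cross at |A| ≈ q^(r-1/3), which separates statements 1 and 2.
Statement 3 is pure arithmetic: its hypothesis already bounds |A + A| from below. -/

theorem card_maximalIdeal_mul_residueCard :
    Nat.card (IsLocalRing.maximalIdeal R) * residueCard R = Nat.card R :=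
  (IsLocalRing.maximalIdeal R).toAddSubgroup.card_mul_index

theorem isUnit_two_of_odd_residueCard (h : Odd (residueCard R)) : IsUnit (2 : R) := by
  by_contra h2
  have hz : (2 : R ⧸ IsLocalRing.maximalIdeal R) = 0 := by
    have : (2 : R) ∈ IsLocalRing.maximalIdeal R := h2
    exact (map_ofNat (Ideal.Quotient.mk (IsLocalRing.maximalIdeal R)) 2).symm.trans
      (Ideal.Quotient.eq_zero_iff_mem.2 this)
  have hodd : (residueCard R : R ⧸ IsLocalRing.maximalIdeal R) = 0 := by
    have := card_nsmul_eq_zero' (G := R ⧸ IsLocalRing.maximalIdeal R) (x := 1)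
    simpa [residueCard] using this
  obtain ⟨k, hk⟩ := h
  rw [hk] at hodd
  push_cast at hodd
  rw [hz, zero_mul, zero_add] at hodd
  exact one_ne_zero hodd

/-- Multiplication by z^k carries R onto 𝔪^k and 𝔪 onto 𝔪^(k+1). Its kernel lies in 𝔪 since z^k ≠ 0,
so each step of the filtration has index q. -/
theorem index_maximalIdeal_pow [IsPrincipalIdealRing R] (k : ℕ)
    (hk : ∀ j < k, IsLocalRing.maximalIdeal R ^ j ≠ ⊥) :
    (IsLocalRing.maximalIdeal R ^ k).toAddSubgroup.index = residueCard R ^ k := by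
  induction k with
  | zero => simp
  | succ k ih =>
    obtain ⟨z, hz⟩ := (IsPrincipalIdealRing.principal (IsLocalRing.maximalIdeal R)).principal
    rw [Ideal.submodule_span_eq] at hz
    have hzk : ∀ j, IsLocalRing.maximalIdeal R ^ j = Ideal.span {z ^ j} := fun j => by
      rw [hz, Ideal.span_singleton_pow]
    have hne : z ^ k ≠ 0 := fun h => hk k (Nat.lt_succ_self k) (by rw [hzk, h]; simp)
    have hle : (IsLocalRing.maximalIdeal R ^ (k + 1)).toAddSubgroup ≤
        (IsLocalRing.maximalIdeal R ^ k).toAddSubgroup := Ideal.pow_le_pow_right (Nat.le_succ k)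
    rw [← AddSubgroup.relIndex_mul_index hle, ih fun j hj => hk j (hj.trans (Nat.lt_succ_self k)),
      pow_succ' (residueCard R)]
    congr 1
    let f : R →+ R := AddMonoidHom.mulLeft (z ^ k)
    have h1 : (IsLocalRing.maximalIdeal R ^ (k + 1)).toAddSubgroup =
        (IsLocalRing.maximalIdeal R).toAddSubgroup.map f := by
      ext x
      rw [hzk]
      conv_rhs => rw [hz]
      simp only [Submodule.mem_toAddSubgroup, Ideal.mem_span_singleton', AddSubgroup.mem_map, f,
        AddMonoidHom.coe_mulLeft]
      constructor
      · rintro ⟨a, rfl⟩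
        exact ⟨a * z, ⟨a, rfl⟩, by ring⟩
      · rintro ⟨_, ⟨a, rfl⟩, rfl⟩
        exact ⟨a, by ring⟩
    have h2 : (IsLocalRing.maximalIdeal R ^ k).toAddSubgroup = (⊤ : AddSubgroup R).map f := by
      ext x
      rw [hzk]
      simp only [Submodule.mem_toAddSubgroup, Ideal.mem_span_singleton', AddSubgroup.mem_map, f,
        AddMonoidHom.coe_mulLeft, AddSubgroup.mem_top, true_and, mul_comm]
    have hker : f.ker ≤ (IsLocalRing.maximalIdeal R).toAddSubgroup := by
      intro x hx
      rw [AddMonoidHom.mem_ker] at hx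
      change x ∈ IsLocalRing.maximalIdeal R
      rw [IsLocalRing.mem_maximalIdeal, mem_nonunits_iff]
      exact fun hu => hne ((hu.mul_left_eq_zero).1 hx)
    rw [h1, h2, AddSubgroup.relIndex_map_map, sup_eq_left.2 hker, top_sup_eq,
      AddSubgroup.relIndex_top_right]
    rfl

variable [Finite R]

theorem nilpotencyDegree_spec :
    0 < nilpotencyDegree R ∧ IsLocalRing.maximalIdeal R ^ nilpotencyDegree R = ⊥ := by
  apply Nat.sInf_mem (s := {k : ℕ | 0 < k ∧ IsLocalRing.maximalIdeal R ^ k = ⊥})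
  obtain ⟨k, hk⟩ := IsArtinianRing.isNilpotent_jacobson_bot (R := R)
  rw [IsLocalRing.jacobson_eq_maximalIdeal ⊥ bot_ne_top] at hk
  exact ⟨k + 1, k.succ_pos, by rw [pow_succ, hk]; simp⟩

theorem card_eq_residueCard_pow_nilpotencyDegree [IsPrincipalIdealRing R] :
    Nat.card R = residueCard R ^ nilpotencyDegree R := by
  rw [← index_maximalIdeal_pow, nilpotencyDegree_spec.2]
  · exact (AddSubgroup.index_bot (G := R)).symm
  · intro j hj h
    rcases Nat.eq_zero_or_pos j with rfl | hj0
    · rw [pow_zero, Ideal.one_eq_top] at h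
      exact top_ne_bot h
    · exact Nat.notMem_of_lt_sInf hj ⟨hj0, h⟩

end Cardinality

/-! ### Point–parabola incidences by second moments. -/

section Incidence

variable {R : Type*} [CommRing R] [Fintype R] [DecidableEq R]

/-- The points of `P` on the parabola `t - e = (s - b) ^ 2` with vertex `v = (b, e)`. -/
def parabolaPoints (P : Finset (R × R)) (v : R × R) : Finset (R × R) :=
  P.filter fun p => p.2 - (p.1 - v.1) ^ 2 = v.2

theorem sum_parabolaPoints_card (P : Finset (R × R)) :
    ∑ v, (parabolaPoints P v).card = Fintype.card R * P.card := by
  simp only [parabolaPoints, Finset.card_filter]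
  rw [Finset.sum_comm, Finset.sum_congr rfl (g := fun _ => Fintype.card R), Finset.sum_const,
    smul_eq_mul, mul_comm]
  intro p _
  rw [Fintype.sum_prod_type]
  simp

theorem sum_parabolaPoints_card_sq_eq (P : Finset (R × R)) :
    ∑ v, (parabolaPoints P v).card ^ 2 = ∑ p ∈ P, ∑ p' ∈ P,
      (Finset.univ.filter fun b : R => p.2 - (p.1 - b) ^ 2 = p'.2 - (p'.1 - b) ^ 2).card := by
  simp only [parabolaPoints, Finset.card_filter, sq (Finset.sum _ _), Finset.sum_mul_sum]
  rw [Finset.sum_comm]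
  refine Finset.sum_congr rfl fun p _ => ?_
  rw [Finset.sum_comm]
  refine Finset.sum_congr rfl fun p' _ => ?_
  rw [Fintype.sum_prod_type]
  refine Finset.sum_congr rfl fun b _ => ?_
  simp [eq_comm]

variable [IsLocalRing R]

/-- Two points lie on a common parabola with vertex abscissa b exactly when an equation linear in b,
with slope 2(s - s'), holds. A unit slope allows at most one b. -/
theorem sum_parabolaPoints_card_sq_le (h2 : IsUnit (2 : R)) (P : Finset (R × R)) :
    ∑ v, (parabolaPoints P v).card ^ 2 ≤
      P.card * (P.card + Nat.card (IsLocalRing.maximalIdeal R) * Fintype.card R) := by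
  classical
  rw [sum_parabolaPoints_card_sq_eq, ← smul_eq_mul, ← Finset.sum_const]
  refine Finset.sum_le_sum fun p _ => ?_
  rw [← Finset.sum_filter_add_sum_filter_not P (fun p' => IsUnit (p.1 - p'.1))]
  refine Nat.add_le_add ?_ ?_
  · refine (Finset.sum_le_card_nsmul _ _ 1 fun p' hp' => ?_).trans ?_
    · have hu := (Finset.mem_filter.1 hp').2
      refine Finset.card_le_one.2 fun b hb b' hb' => ?_
      simp only [Finset.mem_filter, Finset.mem_univ, true_and] at hb hb'
      refine (hu.mul h2).mul_left_cancel ?_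
      linear_combination hb - hb'
    · simpa using Finset.card_filter_le _ _
  · rw [← Finset.card_sigma, Nat.card_eq_fintype_card, ← Fintype.card_prod]
    have hm : ∀ x ∈ (P.filter fun p' => ¬IsUnit (p.1 - p'.1)).sigma fun p' =>
        Finset.univ.filter fun b : R => p.2 - (p.1 - b) ^ 2 = p'.2 - (p'.1 - b) ^ 2,
        p.1 - x.1.1 ∈ IsLocalRing.maximalIdeal R ∧
          p.2 - (p.1 - x.2) ^ 2 = x.1.2 - (x.1.1 - x.2) ^ 2 := by
      intro x hx
      simp only [Finset.mem_sigma, Finset.mem_filter, Finset.mem_univ, true_and] at hx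
      exact ⟨hx.1.2, hx.2⟩
    rw [← Finset.card_univ (α := IsLocalRing.maximalIdeal R × R)]
    -- For a non-unit difference, s - s' ∈ 𝔪 and b together determine the second point, leaving at
    -- most nN pairs.
    refine Finset.card_le_card_of_surjOn
      (fun y => ⟨(p.1 - y.1, p.2 - (p.1 - y.2) ^ 2 + (p.1 - y.1 - y.2) ^ 2), y.2⟩) ?_
    intro x hx
    obtain ⟨h, h'⟩ := hm x hx
    refine ⟨(⟨_, h⟩, x.2), Finset.mem_coe.2 (Finset.mem_univ _), ?_⟩
    obtain ⟨⟨x1, x2⟩, b⟩ := x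
    simp only [sub_sub_cancel, Sigma.mk.injEq, Prod.mk.injEq, true_and, heq_eq_eq, and_true]
      at h' ⊢
    rw [h', sub_add_cancel]

/-- A random parabola among all N² carries |P|/N points on average. The second moment bounds the
variance, and Cauchy–Schwarz over L finishes. -/
theorem parabola_incidence_bound (h2 : IsUnit (2 : R)) (P L : Finset (R × R)) :
    ((Fintype.card R : ℝ) * ∑ v ∈ L, ((parabolaPoints P v).card : ℝ) - P.card * L.card) ^ 2 ≤
      L.card * P.card * (Fintype.card R : ℝ) ^ 3 * Nat.card (IsLocalRing.maximalIdeal R) := by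
  have h1 : ∑ v, ((parabolaPoints P v).card : ℝ) = (Fintype.card R : ℝ) * P.card := by
    exact_mod_cast sum_parabolaPoints_card P
  have hsq : ∑ v, ((parabolaPoints P v).card : ℝ) ^ 2 ≤ P.card *
      (P.card + (Nat.card (IsLocalRing.maximalIdeal R) : ℝ) * (Fintype.card R : ℝ)) := by
    exact_mod_cast sum_parabolaPoints_card_sq_le h2 P
  set N : ℝ := ((Fintype.card R : ℕ) : ℝ) with hN
  set n : ℝ := ((Nat.card (IsLocalRing.maximalIdeal R) : ℕ) : ℝ) with hn
  have hvar : ∑ v : R × R, (N * (parabolaPoints P v).card - P.card) ^ 2 ≤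
      P.card * N ^ 3 * n := by
    have : ∑ v : R × R, (N * (parabolaPoints P v).card - P.card) ^ 2 =
        N ^ 2 * (∑ v, ((parabolaPoints P v).card : ℝ) ^ 2) - N ^ 2 * (P.card : ℝ) ^ 2 := by
      have : ∀ v : R × R, (N * (parabolaPoints P v).card - P.card) ^ 2 =
          N ^ 2 * ((parabolaPoints P v).card : ℝ) ^ 2 -
            2 * N * P.card * (parabolaPoints P v).card + (P.card : ℝ) ^ 2 := fun v => by ring
      simp only [this, Finset.sum_add_distrib, Finset.sum_sub_distrib, ← Finset.mul_sum, h1]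
      simp only [Finset.sum_const, Finset.card_univ, Fintype.card_prod, nsmul_eq_mul,
        Nat.cast_mul, ← hN]
      ring
    rw [this]
    nlinarith [mul_le_mul_of_nonneg_left hsq (sq_nonneg N)]
  have hsum : N * ∑ v ∈ L, ((parabolaPoints P v).card : ℝ) - P.card * L.card =
      ∑ v ∈ L, (N * (parabolaPoints P v).card - P.card) := by
    rw [Finset.sum_sub_distrib, ← Finset.mul_sum, Finset.sum_const, nsmul_eq_mul]
    ring
  rw [hsum]
  calc _ ≤ (L.card : ℝ) * ∑ v ∈ L, (N * (parabolaPoints P v).card - P.card) ^ 2 :=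
        sq_sum_le_card_mul_sum_sq
    _ ≤ (L.card : ℝ) * ∑ v : R × R, (N * (parabolaPoints P v).card - P.card) ^ 2 := by
        gcongr
        exact Finset.subset_univ L
    _ ≤ (L.card : ℝ) * (P.card * N ^ 3 * n) := by gcongr
    _ = _ := by ring

end Incidence

/-! ### Sum sets of sets of units. -/

section UnitSets

variable {R : Type*} [CommRing R] [DecidableEq R]

/-- If x² = w² with x a unit, the factors x - w and x + w add up to the unit 2x. By locality one is
a unit, so the other vanishes. -/
theorem card_le_two_mul_card_squares [IsLocalRing R] (h2 : IsUnit (2 : R)) (B : Finset R)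
    (hB : ∀ b ∈ B, IsUnit b) : B.card ≤ 2 * (squares B).card := by
  refine Finset.card_le_mul_card_image B 2 fun y hy => ?_
  obtain ⟨x, hx, rfl⟩ := Finset.mem_image.1 hy
  refine (Finset.card_le_card (t := {x, -x}) fun w hw => ?_).trans Finset.card_le_two
  obtain ⟨-, hw2⟩ := Finset.mem_filter.1 hw
  have h0 : (x - w) * (x + w) = 0 := by linear_combination -hw2
  have hu : IsUnit ((x - w) + (x + w)) := by
    have := h2.mul (hB x hx)
    convert this using 1
    ring
  rcases IsLocalRing.isUnit_or_isUnit_of_isUnit_add hu with h | h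
  · have := (h.mul_right_eq_zero).1 h0
    simp [eq_neg_of_add_eq_zero_right this]
  · have := (h.mul_left_eq_zero).1 h0
    simp [sub_eq_zero.1 this]

theorem sum_parabolaPoints_card_ge [Fintype R] (B : Finset R) :
    B.card * (B.card * (squares B).card) ≤ ∑ v ∈ B ×ˢ squares B,
      (parabolaPoints ((B + B) ×ˢ (squares B + squares B)) v).card := by
  rw [← Finset.card_product, mul_comm, ← smul_eq_mul, ← Finset.sum_const]
  refine Finset.sum_le_sum fun v hv => ?_
  obtain ⟨hb, he⟩ := Finset.mem_product.1 hv
  refine Finset.card_le_card_of_injOn (fun a => (a + v.1, a ^ 2 + v.2)) (fun a ha => ?_)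
    fun a _ a' _ h => by simpa using congrArg Prod.fst h
  simp only [parabolaPoints, Finset.coe_filter, Set.mem_ofPred_eq, Finset.mem_product]
  exact ⟨⟨Finset.add_mem_add ha hb, Finset.add_mem_add (Finset.mem_image_of_mem _ ha) he⟩,
    by ring⟩

theorem card_sumset_mul_card_sumset_squares_ge [Fintype R] [IsLocalRing R] (h2 : IsUnit (2 : R)) (B : Finset R)
    (hB : ∀ b ∈ B, IsUnit b) :
    min ((Fintype.card R : ℝ) * B.card / 2)
      ((B.card : ℝ) ^ 4 / (8 * Fintype.card R * Nat.card (IsLocalRing.maximalIdeal R))) ≤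
      (B + B).card * (squares B + squares B).card := by
  have hI := parabola_incidence_bound h2 ((B + B) ×ˢ (squares B + squares B)) (B ×ˢ squares B)
  have hge : (B.card : ℝ) * (B.card * (squares B).card) ≤ ∑ v ∈ B ×ˢ squares B,
      ((parabolaPoints ((B + B) ×ˢ (squares B + squares B)) v).card : ℝ) := by
    exact_mod_cast sum_parabolaPoints_card_ge B
  have hsq : (B.card : ℝ) ≤ 2 * (squares B).card := by
    exact_mod_cast card_le_two_mul_card_squares h2 B hB
  have hN : (0 : ℝ) < Fintype.card R := by exact_mod_cast Fintype.card_pos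
  have hn : (0 : ℝ) < Nat.card (IsLocalRing.maximalIdeal R) := by exact_mod_cast Nat.card_pos
  simp only [Finset.card_product, Nat.cast_mul] at hI
  set X : ℝ := ((B + B).card : ℝ) * ((squares B + squares B).card : ℝ)
  have hX0 : 0 ≤ X := by positivity
  set I := ∑ v ∈ B ×ˢ squares B,
      ((parabolaPoints ((B + B) ×ˢ (squares B + squares B)) v).card : ℝ)
  set N : ℝ := ((Fintype.card R : ℕ) : ℝ)
  set n : ℝ := ((Nat.card (IsLocalRing.maximalIdeal R) : ℕ) : ℝ)
  set β : ℝ := ((B.card : ℕ) : ℝ) with hβ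
  set γ : ℝ := (((squares B).card : ℕ) : ℝ)
  rcases (Nat.cast_nonneg (α := ℝ) B.card).eq_or_lt with h0 | hpos
  · rw [← hβ] at h0
    rw [← h0]
    simpa using hX0
  rw [← hβ] at hpos
  have hγ : 0 < γ := by linarith
  rw [min_le_iff]
  by_contra! hcon
  obtain ⟨hc1, hc2⟩ := hcon
  rw [lt_div_iff₀ (by positivity)] at hc2
  -- If the grid has fewer than Nβ/2 points, the expected count is under half the actual one, so the
  -- error term must account for the rest.
  have hlow : N * β * (β * γ) / 2 ≤ N * I - X * (β * γ) := by
    nlinarith [mul_le_mul_of_nonneg_left hge hN.le,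
      mul_lt_mul_of_pos_right hc1 (mul_pos hpos hγ)]
  have hsq2 := pow_le_pow_left₀ (by positivity) hlow 2
  have h3 : (N * β * (β * γ) / 2) ^ 2 ≤ β * γ * X * N ^ 3 * n := hsq2.trans hI
  have h4 : β * γ * N ^ 2 * (β ^ 3 * γ) ≤ β * γ * N ^ 2 * (4 * (X * N * n)) := by
    linarith [h3, show (N * β * (β * γ) / 2) ^ 2 = β * γ * N ^ 2 * (β ^ 3 * γ) / 4 by ring,
      show β * γ * N ^ 2 * (4 * (X * N * n)) = 4 * (β * γ * X * N ^ 3 * n) by ring]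
  have h5 := le_of_mul_le_mul_left h4 (by positivity)
  nlinarith [mul_le_mul_of_nonneg_left hsq (pow_pos hpos 3).le]

end UnitSets

/-! ### Passing from units to arbitrary sets. -/

section MaxSumset

theorem card_le_card_filter_isUnit_add {R : Type*} [CommRing R] [IsLocalRing R] [Finite R]
    (A : Finset R) [DecidablePred (IsUnit : R → Prop)] :
    A.card ≤ (A.filter IsUnit).card + Nat.card (IsLocalRing.maximalIdeal R) := by
  classical
  have := Fintype.ofFinite R
  rw [← Finset.card_filter_add_card_filter_not (s := A) IsUnit]
  gcongr
  rw [Nat.card_eq_fintype_card, Fintype.card_subtype]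
  refine Finset.card_le_card fun x hx => ?_
  simpa using (Finset.mem_filter.1 hx).2

variable {R : Type*} [CommRing R] [DecidableEq R]

theorem card_add_self_le_maxSumset (A : Finset R) : ((A + A).card : ℝ) ≤ maxSumset A :=
  Nat.cast_le.2 (le_max_left _ _)

theorem card_le_maxSumset (A : Finset R) : (A.card : ℝ) ≤ maxSumset A := by
  refine le_trans ?_ (card_add_self_le_maxSumset A)
  rcases A.eq_empty_or_nonempty with rfl | hA
  · simp
  · exact_mod_cast Finset.card_le_card_add_right hA

theorem card_mul_card_le_maxSumset_sq {A B : Finset R} (h : B ⊆ A) :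
    ((B + B).card : ℝ) * (squares B + squares B).card ≤ maxSumset A ^ 2 := by
  have hs : squares B ⊆ squares A := Finset.image_subset_image h
  rw [sq]
  refine mul_le_mul (Nat.cast_le.2 ?_) (Nat.cast_le.2 ?_) (Nat.cast_nonneg _) (Nat.cast_nonneg _)
  · exact (Finset.card_le_card (Finset.add_subset_add h h)).trans (le_max_left _ _)
  · exact (Finset.card_le_card (Finset.add_subset_add hs hs)).trans (le_max_right _ _)

variable [IsLocalRing R] [Finite R]

/-- The hypothesis is |A| ≥ c q^(r-3/8) with fractional powers cleared. -/
theorem maxSumset_sq_ge (hq : Odd (residueCard R)) {c : ℝ} (hc : 0 < c) (A : Finset R)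
    (hA : (c * Nat.card R) ^ 8 ≤ (A.card : ℝ) ^ 8 * (residueCard R : ℝ) ^ 3) :
    min (1 / 128) (c ^ 8 / 2 ^ 8) * min ((Nat.card R : ℝ) * A.card)
      ((A.card : ℝ) ^ 4 * residueCard R / (Nat.card R : ℝ) ^ 2) ≤ maxSumset A ^ 2 := by
  classical
  have := Fintype.ofFinite R
  have h2 := isUnit_two_of_odd_residueCard hq
  have hqn : (Nat.card (IsLocalRing.maximalIdeal R) : ℝ) * residueCard R = Nat.card R := by
    exact_mod_cast card_maximalIdeal_mul_residueCard (R := R)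
  have hq1 : (1 : ℝ) ≤ residueCard R := by exact_mod_cast hq.pos
  have haN : (A.card : ℝ) ≤ Nat.card R := by
    rw [Nat.card_eq_fintype_card]
    exact_mod_cast Finset.card_le_univ A
  have hN : (0 : ℝ) < Nat.card R := by exact_mod_cast Nat.card_pos
  have hn : (0 : ℝ) < Nat.card (IsLocalRing.maximalIdeal R) := by exact_mod_cast Nat.card_pos
  have hdec : (A.card : ℝ) ≤
      (A.filter IsUnit).card + Nat.card (IsLocalRing.maximalIdeal R) := by
    exact_mod_cast card_le_card_filter_isUnit_add A
  have hmain := (card_sumset_mul_card_sumset_squares_ge h2 (A.filter IsUnit)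
    fun b hb => (Finset.mem_filter.1 hb).2).trans
      (card_mul_card_le_maxSumset_sq (Finset.filter_subset _ A))
  have htriv := card_le_maxSumset A
  rw [← Nat.card_eq_fintype_card] at hmain
  set β : ℝ := (((A.filter IsUnit).card : ℕ) : ℝ)
  set N : ℝ := ((Nat.card R : ℕ) : ℝ)
  set n : ℝ := ((Nat.card (IsLocalRing.maximalIdeal R) : ℕ) : ℝ)
  set q : ℝ := ((residueCard R : ℕ) : ℝ)
  set M := maxSumset A
  set a : ℝ := ((A.card : ℕ) : ℝ) with ha
  have ha0 : 0 ≤ a := Nat.cast_nonneg _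
  have hmin0 : 0 ≤ min (N * a) (a ^ 4 * q / N ^ 2) := le_min (by positivity) (by positivity)
  -- Either q is bounded in terms of c and M ≥ |A| suffices, or |A| ≥ 2n and at least half of A
  -- consists of units. The 1/128 is (1/2)⁴/8.
  rcases lt_or_ge (c ^ 8 * q ^ 5) (2 ^ 8) with hsmall | hlarge
  · have hcq : c ^ 8 / 2 ^ 8 * q ≤ 1 := by
      have : q ≤ q ^ 5 := le_self_pow₀ hq1 (by norm_num)
      have : c ^ 8 * q ≤ c ^ 8 * q ^ 5 := by gcongr
      linarith
    have h4 : a ^ 4 * q / N ^ 2 ≤ q * a ^ 2 := by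
      rw [div_le_iff₀ (by positivity)]
      have : a ^ 2 ≤ N ^ 2 := by gcongr
      nlinarith [mul_le_mul_of_nonneg_left this (by positivity : 0 ≤ q * a ^ 2)]
    calc _ ≤ c ^ 8 / 2 ^ 8 * (q * a ^ 2) := by
          refine mul_le_mul (min_le_right _ _) ((min_le_right _ _).trans h4) hmin0 (by positivity)
      _ ≤ 1 * a ^ 2 := by rw [← mul_assoc]; gcongr
      _ ≤ M ^ 2 := by rw [one_mul]; gcongr
  · have h2n : 2 * n ≤ a := by
      have h8 : (2 * n) ^ 8 * q ^ 3 ≤ a ^ 8 * q ^ 3 := by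
        refine le_trans ?_ hA
        rw [← hqn]
        nlinarith [mul_le_mul_of_nonneg_left hlarge (by positivity : 0 ≤ n ^ 8 * q ^ 3)]
      exact le_of_pow_le_pow_left₀ (by norm_num) ha0
        (le_of_mul_le_mul_right h8 (by positivity))
    have hβ : a / 2 ≤ β := by linarith
    refine le_trans ?_ hmain
    refine le_min ?_ ?_
    · calc _ ≤ 1 / 128 * (N * a) :=
            mul_le_mul (min_le_left _ _) (min_le_left _ _) hmin0 (by norm_num)
        _ ≤ N * (a / 2) / 2 := by nlinarith [mul_nonneg hN.le ha0]
        _ ≤ _ := by gcongr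
    · calc _ ≤ 1 / 128 * (a ^ 4 * q / N ^ 2) :=
            mul_le_mul (min_le_left _ _) (min_le_right _ _) hmin0 (by norm_num)
        _ = (a / 2) ^ 4 / (8 * N * n) := by
            rw [← hqn]
            field_simp
            ring
        _ ≤ _ := by gcongr

end MaxSumset

/-! ### The three ranges of |A|. -/

theorem corollary1p8 :
    (∀ c : ℝ, 0 < c → ∃ C : ℝ, 0 < C ∧
      ∀ (R : Type*) [CommRing R] [Finite R] [IsLocalRing R] [IsPrincipalIdealRing R]
        [DecidableEq R] (q r : ℕ), q = residueCard R → r = nilpotencyDegree R → Odd q →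
      ∀ A : Finset R,
        c * (q : ℝ) ^ ((r : ℝ) - 1 / 3) ≤ (A.card : ℝ) →
        C * ((q : ℝ) ^ ((r : ℝ) / 2) * (A.card : ℝ) ^ (1 / 2 : ℝ)) ≤ maxSumset A) ∧
    (∀ c₁ c₂ : ℝ, 0 < c₁ → 0 < c₂ → ∃ C : ℝ, 0 < C ∧
      ∀ (R : Type*) [CommRing R] [Finite R] [IsLocalRing R] [IsPrincipalIdealRing R]
        [DecidableEq R] (q r : ℕ), q = residueCard R → r = nilpotencyDegree R → Odd q →
      ∀ A : Finset R,
        c₁ * (q : ℝ) ^ ((r : ℝ) - 3 / 8) ≤ (A.card : ℝ) →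
        (A.card : ℝ) ≤ c₂ * (q : ℝ) ^ ((r : ℝ) - 1 / 3) →
        C * ((A.card : ℝ) ^ 2 / (q : ℝ) ^ ((2 * (r : ℝ) - 1) / 2)) ≤ maxSumset A) ∧
    (∀ c₁ c₂ : ℝ, 0 < c₁ → 0 < c₂ → ∃ C : ℝ, 0 < C ∧
      ∀ (R : Type*) [CommRing R] [Finite R] [IsLocalRing R] [IsPrincipalIdealRing R]
        [DecidableEq R] (q r : ℕ), q = residueCard R → r = nilpotencyDegree R → Odd q →
      ∀ A : Finset R,
        c₁ * (q : ℝ) ^ (3 * (r : ℝ) - 1) ≤ ((A + A).card : ℝ) * (A.card : ℝ) ^ 2 →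
        2 * (q : ℝ) ^ ((r : ℝ) - 1) ≤ (A.card : ℝ) →
        (A.card : ℝ) ≤ c₂ * (q : ℝ) ^ ((r : ℝ) - 3 / 8) →
        C * ((q : ℝ) ^ ((r : ℝ) / 3) * (A.card : ℝ) ^ (2 / 3 : ℝ)) ≤ maxSumset A) := by
  have rp : ∀ {x : ℝ}, 0 < x → ∀ (y : ℝ) (k : ℕ), (x ^ y) ^ k = x ^ (y * k) := fun hx y k => by
    rw [Real.rpow_mul hx.le, Real.rpow_natCast]
  have p38 : ∀ {x : ℝ}, 0 < x → ∀ r : ℕ, (x ^ ((r : ℝ) - 3 / 8)) ^ 8 * x ^ 3 = (x ^ r) ^ 8 :=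
    fun hx r => by
      rw [rp hx, ← Real.rpow_natCast _ 3, ← Real.rpow_add hx, ← pow_mul, ← Real.rpow_natCast]
      congr 1
      push_cast
      ring
  have p13 : ∀ {x : ℝ}, 0 < x → ∀ r : ℕ, (x ^ ((r : ℝ) - 1 / 3)) ^ 3 * x = (x ^ r) ^ 3 :=
    fun {x} hx r => by
      nth_rewrite 2 [← Real.rpow_one x]
      rw [rp hx, ← Real.rpow_add hx, ← pow_mul, ← Real.rpow_natCast]
      congr 1
      push_cast
      ring
  refine ⟨?_, ?_, ?_⟩
  · intro c hc
    -- Here |A|³q ≥ c³N³, so both terms of the minimum are at least min(1, c³)·N|A|.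
    refine ⟨√(min (1 / 128) (c ^ 8 / 2 ^ 8) * min 1 (c ^ 3)), by positivity, ?_⟩
    intro R _ _ _ _ _ q r hq hr hodd A hA
    have hcard := card_eq_residueCard_pow_nilpotencyDegree (R := R)
    rw [← hq, ← hr] at hcard
    have hcard' : (Nat.card R : ℝ) = (q : ℝ) ^ r := by exact_mod_cast hcard
    have hq1 : (1 : ℝ) ≤ q := by exact_mod_cast hodd.pos
    have hq0 : (0 : ℝ) < q := by linarith
    have hM0 : 0 ≤ maxSumset A := Nat.cast_nonneg _
    have ha0 : (0 : ℝ) ≤ A.card := Nat.cast_nonneg _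
    have hexp : (q : ℝ) ^ ((r : ℝ) - 3 / 8) ≤ (q : ℝ) ^ ((r : ℝ) - 1 / 3) :=
      Real.rpow_le_rpow_of_exponent_le hq1 (by linarith)
    have hmain := maxSumset_sq_ge (hq ▸ hodd) hc A (by
      rw [← hq, hcard', mul_pow, ← p38 hq0, ← mul_assoc, ← mul_pow]
      gcongr
      exact le_trans (by gcongr) hA)
    have hA3 : c ^ 3 * ((q : ℝ) ^ r) ^ 3 ≤ (A.card : ℝ) ^ 3 * q := by
      rw [← p13 hq0, ← mul_assoc, ← mul_pow]
      gcongr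
    rw [← hq, hcard'] at hmain
    refine le_of_pow_le_pow_left₀ two_ne_zero hM0 ?_
    rw [mul_pow, Real.sq_sqrt (by positivity), mul_pow, rp hq0, ← Real.sqrt_eq_rpow,
      Real.sq_sqrt ha0, Nat.cast_ofNat, div_mul_cancel₀ _ two_ne_zero, Real.rpow_natCast]
    refine le_trans ?_ hmain
    rw [mul_assoc]
    gcongr
    set N : ℝ := (q : ℝ) ^ r
    have hN : 0 < N := by positivity
    refine le_min ?_ ?_
    · exact mul_le_of_le_one_left (by positivity) (min_le_left _ _)
    · refine (mul_le_mul_of_nonneg_right (min_le_right _ _) (by positivity)).trans ?_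
      rw [le_div_iff₀ (by positivity)]
      nlinarith [mul_le_mul_of_nonneg_right hA3 ha0]
  · intro c₁ c₂ hc₁ hc₂
    -- Now |A|³q ≤ c₂³N³, so N|A| is at least |A|⁴q/N² divided by c₂³.
    refine ⟨√(min (1 / 128) (c₁ ^ 8 / 2 ^ 8) * min 1 (1 / c₂ ^ 3)), by positivity, ?_⟩
    intro R _ _ _ _ _ q r hq hr hodd A hA hA'
    have hcard := card_eq_residueCard_pow_nilpotencyDegree (R := R)
    rw [← hq, ← hr] at hcard
    have hcard' : (Nat.card R : ℝ) = (q : ℝ) ^ r := by exact_mod_cast hcard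
    have hq0 : (0 : ℝ) < q := by exact_mod_cast hodd.pos
    have hM0 : 0 ≤ maxSumset A := Nat.cast_nonneg _
    have ha0 : (0 : ℝ) ≤ A.card := Nat.cast_nonneg _
    have hmain := maxSumset_sq_ge (hq ▸ hodd) hc₁ A (by
      rw [← hq, hcard', mul_pow, ← p38 hq0, ← mul_assoc, ← mul_pow]
      gcongr)
    have hA3 : (A.card : ℝ) ^ 3 * q ≤ c₂ ^ 3 * ((q : ℝ) ^ r) ^ 3 := by
      rw [← p13 hq0, ← mul_assoc, ← mul_pow]
      gcongr
    rw [← hq, hcard'] at hmain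
    have hden : ((q : ℝ) ^ ((2 * (r : ℝ) - 1) / 2)) ^ 2 = ((q : ℝ) ^ r) ^ 2 / q := by
      rw [rp hq0, Nat.cast_ofNat, div_mul_cancel₀ _ two_ne_zero, Real.rpow_sub hq0,
        Real.rpow_one, ← pow_mul, ← Real.rpow_natCast]
      congr 2
      push_cast
      ring
    refine le_of_pow_le_pow_left₀ two_ne_zero hM0 ?_
    rw [mul_pow, Real.sq_sqrt (by positivity), div_pow, hden]
    refine le_trans ?_ hmain
    rw [mul_assoc]
    gcongr
    set N : ℝ := (q : ℝ) ^ r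
    have hN : 0 < N := by positivity
    rw [show ((A.card : ℝ) ^ 2) ^ 2 / (N ^ 2 / q) = (A.card : ℝ) ^ 4 * q / N ^ 2 by
      field_simp]
    refine le_min ?_ ?_
    · refine (mul_le_mul_of_nonneg_right (min_le_right _ _) (by positivity)).trans ?_
      rw [← mul_div_assoc, div_le_iff₀ (by positivity), one_div_mul_eq_div,
        div_le_iff₀ (by positivity)]
      nlinarith [mul_le_mul_of_nonneg_right hA3 ha0]
    · exact mul_le_of_le_one_left (by positivity) (min_le_left _ _)
  · intro c₁ c₂ hc₁ hc₂
    -- Cube M|A|² ≥ c₁N³/q, then use |A|⁸q³ ≤ c₂⁸N⁸ to get M³ ≥ (c₁³/c₂⁸)N|A|².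
    refine ⟨(c₁ ^ 3 / c₂ ^ 8) ^ (1 / 3 : ℝ), by positivity, ?_⟩
    intro R _ _ _ _ _ q r hq hr hodd A hS hA hA'
    have hq0 : (0 : ℝ) < q := by exact_mod_cast hodd.pos
    have hM0 : 0 ≤ maxSumset A := Nat.cast_nonneg _
    have ha : (0 : ℝ) < A.card := lt_of_lt_of_le (by positivity) hA
    have hA8 : (A.card : ℝ) ^ 8 * q ^ 3 ≤ c₂ ^ 8 * ((q : ℝ) ^ r) ^ 8 := by
      rw [← p38 hq0, ← mul_assoc, ← mul_pow]
      gcongr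
    have hS' : c₁ * ((q : ℝ) ^ r) ^ 3 / q ≤ maxSumset A * (A.card : ℝ) ^ 2 := by
      refine le_trans (le_of_eq ?_) (hS.trans ?_)
      · rw [mul_div_assoc, Real.rpow_sub hq0, Real.rpow_one, ← pow_mul, ← Real.rpow_natCast]
        congr 3
        push_cast
        ring
      · gcongr
        exact card_add_self_le_maxSumset A
    refine le_of_pow_le_pow_left₀ three_ne_zero hM0 ?_
    have h13 : (1 / 3 : ℝ) * (3 : ℕ) = 1 := by norm_num
    have h23 : (2 / 3 : ℝ) * (3 : ℕ) = (2 : ℕ) := by norm_num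
    have hr3 : (r : ℝ) / 3 * (3 : ℕ) = r := by push_cast; ring
    rw [mul_pow, mul_pow, rp (by positivity), rp hq0, rp ha, h13, h23, hr3, Real.rpow_one,
      Real.rpow_natCast, Real.rpow_natCast]
    set N : ℝ := (q : ℝ) ^ r
    have hN : 0 < N := by positivity
    have hS3 := pow_le_pow_left₀ (by positivity) hS' 3
    rw [div_pow, div_le_iff₀ (by positivity)] at hS3
    rw [← mul_div_right_comm, div_le_iff₀ (by positivity)]
    refine le_of_mul_le_mul_right ?_ (by positivity : 0 < (A.card : ℝ) ^ 6 * q ^ 3)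
    calc c₁ ^ 3 * (N * (A.card : ℝ) ^ 2) * ((A.card : ℝ) ^ 6 * q ^ 3)
        = c₁ ^ 3 * N * ((A.card : ℝ) ^ 8 * q ^ 3) := by ring
      _ ≤ c₁ ^ 3 * N * (c₂ ^ 8 * N ^ 8) := by gcongr
      _ = c₂ ^ 8 * (c₁ * N ^ 3) ^ 3 := by ring
      _ ≤ c₂ ^ 8 * ((maxSumset A * (A.card : ℝ) ^ 2) ^ 3 * q ^ 3) := by gcongr
      _ = _ := by ring
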